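/- Let $A$ and $B$ be finite alphabets (with the discrete topology), let $L, M \ge 2$ be integers, and let $\theta : A \to A^{L}$ and $\zeta : B \to B^{M}$ be substitutions of constant lengths $L$ and $M$. A substitution $\theta$ acts on finite words by juxtaposition, $\theta(a_1 \cdots a_k) = \theta(a_1)\cdots\theta(a_k)$; it is \emph{primitive} if there exists $i$ such that every letter of $A$ occurs in $\theta^{i}(a)$ for every $a \in A$. If $\theta$ is primitive, let $X_\theta$ be the smallest closed, shift-invariant subset of $A^{\mathbb Z}$ in which every word $\theta^{i}(a)$, $a \in A$, $i \ge 1$, appears, and let $\sigma$ denote the left shift, $(\sigma x)_i = x_{i+1}$; define $X_\zeta \subseteq B^{\mathbb Z}$ in the same way. Suppose that $\theta$ and $\zeta$ are primitive, that $X_\theta$ and $X_\zeta$ are infinite, and that $(X_\theta,\sigma)$ and $(X_\zeta,\sigma)$ are topologically conjugate, i.e. there is a homeomorphism $\varphi : X_\theta \to X_\zeta$ with $\varphi\circ\sigma = \sigma\circ\varphi$. Then $L$ and $M$ are powers of a common integer: there are positive integers $c, m, n$ with $L = c^{m}$ and $M = c^{n}$. -/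

import Mathlib

namespace ConstantLengthSubstitution

open SymbolicDynamics.FullShift

/-- The dynamical systems `(X, T)` and `(Y, S)` are topologically conjugate: there is a
homeomorphism `φ : X → Y` with `φ ∘ T = S ∘ φ`. -/
def TopologicallyConjugate {X Y : Type*} [TopologicalSpace X] [TopologicalSpace Y]
    (T : X ≃ₜ X) (S : Y ≃ₜ Y) : Prop :=
  ∃ φ : X ≃ₜ Y, φ ∘ T = S ∘ φ

/-- The left shift `(σ x) i = x (i + 1)`, as a homeomorphism of a two-sided subshift. -/
def sigma {A : Type*} [TopologicalSpace A] (X : Subshift A ℤ) : X.carrier ≃ₜ X.carrier where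
  toFun x := ⟨fun i => x.1 (i + 1), by
    have h := X.mapsTo 1 x.2
    rwa [show shift (1 : ℤ) x.1 = fun i => x.1 (i + 1) from
      funext fun i => congrArg x.1 (add_comm 1 i)] at h⟩
  invFun x := ⟨fun i => x.1 (i - 1), by
    have h := X.mapsTo (-1) x.2
    rwa [show shift (-1 : ℤ) x.1 = fun i => x.1 (i - 1) from
      funext fun i => congrArg x.1 (neg_add_eq_sub 1 i)] at h⟩
  left_inv x := Subtype.ext (funext fun i => congrArg x.1 (sub_add_cancel i 1))
  right_inv x := Subtype.ext (funext fun i => congrArg x.1 (add_sub_cancel_right i 1))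
  continuous_toFun := by
    refine Continuous.subtype_mk (continuous_pi fun i => ?_) _
    exact (continuous_apply (i + 1 : ℤ)).comp continuous_subtype_val
  continuous_invFun := by
    refine Continuous.subtype_mk (continuous_pi fun i => ?_) _
    exact (continuous_apply (i - 1 : ℤ)).comp continuous_subtype_val

/-- The action of a substitution `θ : A → A ^ L` on finite words, by juxtaposition:
`θ (a₁ a₂ ⋯ aₖ) = θ a₁ θ a₂ ⋯ θ aₖ`. -/
def onWord {A : Type*} {L : ℕ} (θ : A → Fin L → A) (w : List A) : List A :=
  w.flatMap fun a => List.ofFn (θ a)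

/-- The word `θ ^ i (a)`, of length `L ^ i`. -/
def iteratedWord {A : Type*} {L : ℕ} (θ : A → Fin L → A) (i : ℕ) (a : A) : List A :=
  (onWord θ)^[i] [a]

/-- `θ` is primitive: for some `i`, every letter occurs in every word `θ ^ i (a)`. -/
def IsPrimitive {A : Type*} {L : ℕ} (θ : A → Fin L → A) : Prop :=
  ∃ i : ℕ, ∀ a b : A, b ∈ iteratedWord θ i a

/-- The finite word `w` appears in some point of the subshift `X`. -/
def Appears {A : Type*} [TopologicalSpace A] (w : List A) (X : Subshift A ℤ) : Prop :=
  ∃ x ∈ X.carrier, ∃ n : ℤ, ∀ (j : ℕ) (hj : j < w.length), x (n + j) = w[j]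

/-- Every word `θ ^ i (a)`, with `a` a letter and `i ≥ 1`, appears in the subshift `X`. -/
def AllIteratesAppear {A : Type*} [TopologicalSpace A] {L : ℕ} (θ : A → Fin L → A)
    (X : Subshift A ℤ) : Prop :=
  ∀ a : A, ∀ i : ℕ, 1 ≤ i → Appears (iteratedWord θ i a) X

/-- The subshift `X_θ` generated by `θ`: the intersection of all two-sided subshifts in which
every word `θ ^ i (a)`, `i ≥ 1`, appears. For primitive `θ` of length at least two over a finite
discrete alphabet it is the smallest such subshift. -/
def generatedSubshift {A : Type*} [TopologicalSpace A] {L : ℕ} (θ : A → Fin L → A) :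
    Subshift A ℤ where
  carrier := {x | ∀ X : Subshift A ℤ, AllIteratesAppear θ X → x ∈ X.carrier}
  isClosed := by
    have h : {x : ℤ → A | ∀ X : Subshift A ℤ, AllIteratesAppear θ X → x ∈ X.carrier} =
        ⋂ (X : Subshift A ℤ) (_ : AllIteratesAppear θ X), X.carrier := by
      ext x
      simp
    rw [h]
    exact isClosed_iInter fun X => isClosed_iInter fun _ => X.isClosed
  mapsTo g x hx X hX := X.mapsTo g (hx X hX)

end ConstantLengthSubstitution

namespace ConstantLengthSubstitution

open SymbolicDynamics.FullShift Filter Topology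

/-! The proof compares frequencies of long words, which a conjugacy preserves, in the two systems.
Fix a point `x₀` of the first system and let `d` be the frequency of its prefix of length `L ^ k`.
Frequencies exist and are the same along every orbit (`exists_hasMean`), and `d > 0` because visits
have bounded gaps (`HasMean.pos`). Infiniteness bounds the length of a stretch of period `p` by `K *
p` (`exists_period_bound`), so occurrences of that prefix are at least `L ^ k / K` apart. Hence a
block of length `L ^ k` contains boundedly many, and their number depends only on three consecutive
letters of the desubstituted point. Thus `L ^ k * d` is the mean of one of finitely many functions
on `A × A × A`, and lies in a finite set independent of `k` (`exists_finite_scaled_mean`). A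
conjugacy and its inverse are block codes, so the transported set has the same frequency `d`, is
seen through a window of comparable size, and has the same visit counts. With `M ^ j` chosen
comparable to `L ^ k`, the same argument puts `M ^ j * d` in a second finite set. Dividing, the
ratios `L ^ k / M ^ j` take finitely many values; two coincide, which forces `L ^ a = M ^ b` with
positive exponents. Recognizability is not needed. -/

/-- The action of a substitution of constant length on two-sided sequences. -/
def substitute {A : Type*} {L : ℕ} (θ : A → Fin L → A) (x : ℤ → A) : ℤ → A := fun i =>
  -- The fallback `x i` is reached only for `L = 0`; floor division gives the right block for
  -- negative `i` too.
  if h : (i % L).toNat < L then θ (x (i / L)) ⟨(i % L).toNat, h⟩ else x i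

/-! ### Substitutions on two-sided sequences and on words -/

section Substitute

variable {A : Type*} {L : ℕ} (θ : A → Fin L → A)

lemma toNat_emod_lt (hL : 0 < L) (i : ℤ) : (i % L).toNat < L := by
  have h := Int.emod_lt_of_pos i (Int.natCast_pos.2 hL)
  have h' := Int.emod_nonneg i (Int.natCast_pos.2 hL).ne'
  omega

lemma substitute_apply (hL : 0 < L) (x : ℤ → A) (i : ℤ) :
    substitute θ x i = θ (x (i / L)) ⟨(i % L).toNat, toNat_emod_lt hL i⟩ :=
  dif_pos _

lemma substitute_congr (hL : 0 < L) {x y : ℤ → A} {i : ℤ} (h : x (i / L) = y (i / L)) :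
    substitute θ x i = substitute θ y i := by
  rw [substitute_apply θ hL, substitute_apply θ hL, h]

lemma iterate_substitute_congr (hL : 0 < L) (k : ℕ) {x y : ℤ → A} {i : ℤ}
    (h : x (i / (L : ℤ) ^ k) = y (i / (L : ℤ) ^ k)) :
    (substitute θ)^[k] x i = (substitute θ)^[k] y i := by
  induction k generalizing x y with
  | zero => simpa using h
  | succ k ih =>
    rw [Function.iterate_succ_apply, Function.iterate_succ_apply]
    apply ih
    apply substitute_congr θ hL
    rwa [Int.ediv_ediv_of_nonneg (by positivity), ← pow_succ]

lemma substitute_shift (hL : 0 < L) (q : ℤ) (x : ℤ → A) :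
    substitute θ (shift q x) = shift (q * L) (substitute θ x) := by
  have hL' : (L : ℤ) ≠ 0 := by positivity
  funext i
  rw [shift_apply, substitute_apply θ hL, substitute_apply θ hL]
  have h₁ : (q * L + i) / (L : ℤ) = q + i / L := by
    rw [add_comm, Int.add_mul_ediv_right _ _ hL', add_comm]
  have h₂ : (q * L + i) % (L : ℤ) = i % L := by
    rw [add_comm, Int.add_mul_emod_self_right]
  simp only [shift_apply, h₁, h₂]

lemma iterate_substitute_shift (hL : 0 < L) (k : ℕ) (q : ℤ) (x : ℤ → A) :
    (substitute θ)^[k] (shift q x) = shift (q * (L : ℤ) ^ k) ((substitute θ)^[k] x) := by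
  induction k generalizing q x with
  | zero => simp
  | succ k ih =>
    rw [Function.iterate_succ_apply, Function.iterate_succ_apply, substitute_shift θ hL, ih]
    congr 1
    ring

lemma shift_shift (g h : ℤ) (x : ℤ → A) : shift g (shift h x) = shift (h + g) x :=
  (shift_add h g x).symm

lemma iterate_substitute_block (hL : 0 < L) (k : ℕ) {x y : ℤ → A} (h : x 0 = y 0) {j : ℕ}
    (hj : j < L ^ k) : (substitute θ)^[k] x j = (substitute θ)^[k] y j := by
  apply iterate_substitute_congr θ hL
  rw [Int.ediv_eq_zero_of_lt (by positivity) (by exact_mod_cast hj), h]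

/-- Occurrence of the word `θ ^ k (a)` in `x` at `n`, phrased through `substitute`. -/
lemma iterate_substitute_mul_add (hL : 0 < L) (k : ℕ) (x : ℤ → A) (n : ℤ) {j : ℕ}
    (hj : j < L ^ k) : (substitute θ)^[k] x (n * (L : ℤ) ^ k + j) =
      (substitute θ)^[k] (fun _ => x n) j := by
  have h := congrFun (iterate_substitute_shift θ hL k n x) j
  rw [shift_apply] at h
  rw [← h]
  exact iterate_substitute_block θ hL k (by simp) hj

lemma length_onWord (w : List A) : (onWord θ w).length = L * w.length := by
  induction w with
  | nil => simp [onWord]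
  | cons a w ih =>
    have : onWord θ (a :: w) = List.ofFn (θ a) ++ onWord θ w := by simp [onWord]
    rw [this, List.length_append, ih, List.length_ofFn, List.length_cons]
    ring

lemma getElem_onWord (hL : 0 < L) (w : List A) (x : ℤ → A)
    (h : ∀ (j : ℕ) (hj : j < w.length), x j = w[j]) (j : ℕ) (hj : j < (onWord θ w).length) :
    substitute θ x j = (onWord θ w)[j] := by
  induction w generalizing x j with
  | nil => simp [onWord] at hj
  | cons a w ih =>
    have e : onWord θ (a :: w) = List.ofFn (θ a) ++ onWord θ w := by simp [onWord]
    have h0 : x 0 = a := by exact_mod_cast h 0 (by simp)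
    simp only [e]
    rcases lt_or_ge j L with hjL | hjL
    · rw [List.getElem_append_left (by simpa using hjL), List.getElem_ofFn,
        substitute_apply θ hL]
      have h₁ : (j : ℤ) / L = 0 := Int.ediv_eq_zero_of_lt (by positivity) (by exact_mod_cast hjL)
      have h₂ : (j : ℤ) % L = j := Int.emod_eq_of_lt (by positivity) (by exact_mod_cast hjL)
      simp [h₁, h₂, h0]
    · obtain ⟨t, rfl⟩ := Nat.exists_eq_add_of_le hjL
      rw [List.getElem_append_right (by simp)]
      simp only [List.length_ofFn, Nat.add_sub_cancel_left]
      have ht : t < (onWord θ w).length := by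
        simp only [e, List.length_append, List.length_ofFn] at hj
        omega
      rw [← ih (shift 1 x) _ t ht, substitute_shift θ hL]
      · simp
      · intro i hi
        have := h (i + 1) (by simpa using hi)
        simpa [add_comm] using this

lemma iteratedWord_succ (i : ℕ) (a : A) :
    iteratedWord θ (i + 1) a = onWord θ (iteratedWord θ i a) :=
  Function.iterate_succ_apply' _ _ _

lemma length_iteratedWord (i : ℕ) (a : A) : (iteratedWord θ i a).length = L ^ i := by
  induction i with
  | zero => simp [iteratedWord]
  | succ i ih => rw [iteratedWord_succ, length_onWord, ih, pow_succ']

lemma getElem_iteratedWord (hL : 0 < L) (i : ℕ) (a : A) (j : ℕ)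
    (hj : j < (iteratedWord θ i a).length) :
    (substitute θ)^[i] (fun _ => a) j = (iteratedWord θ i a)[j] := by
  induction i generalizing j with
  | zero => simp [iteratedWord]
  | succ i ih =>
    simp only [iteratedWord_succ, Function.iterate_succ_apply']
    exact getElem_onWord θ hL _ _ ih j _

lemma appears_iteratedWord_iff [TopologicalSpace A] (hL : 0 < L) (i : ℕ) (a : A)
    (X : Subshift A ℤ) : Appears (iteratedWord θ i a) X ↔
      ∃ x ∈ X.carrier, ∀ j : ℕ, j < L ^ i → x j = (substitute θ)^[i] (fun _ => a) j := by
  constructor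
  · rintro ⟨x, hx, n, h⟩
    refine ⟨shift n x, X.mapsTo n hx, fun j hj => ?_⟩
    have hj' : j < (iteratedWord θ i a).length := by rwa [length_iteratedWord]
    rw [getElem_iteratedWord θ hL i a j hj', ← h j hj', shift_apply]
  · rintro ⟨x, hx, h⟩
    refine ⟨x, hx, 0, fun j hj => ?_⟩
    rw [← getElem_iteratedWord θ hL i a j hj, zero_add, h j]
    rwa [length_iteratedWord] at hj

/-- Passing from `m` to `m + 1` makes the exponent positive: the image under `θ ^ (m + 1)` begins
with `θ ^ m` of a letter. -/
lemma IsPrimitive.exists_pos_forall_exists {θ : A → Fin L → A} (hθ : IsPrimitive θ)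
    (hL : 0 < L) : ∃ m, 1 ≤ m ∧ ∀ x : ℤ → A, ∀ b : A,
      ∃ j : ℕ, j < L ^ m ∧ (substitute θ)^[m] x j = b := by
  obtain ⟨m, hm⟩ := hθ
  refine ⟨m + 1, by omega, fun x b => ?_⟩
  obtain ⟨j, hj, h⟩ := List.getElem_of_mem (hm (substitute θ x 0) b)
  have hj' : j < L ^ m := by rwa [length_iteratedWord] at hj
  refine ⟨j, hj'.trans_le (Nat.pow_le_pow_right hL (by omega)), ?_⟩
  rw [Function.iterate_succ_apply, ← h, ← getElem_iteratedWord θ hL]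
  exact iterate_substitute_block θ hL m (y := fun _ => substitute θ x 0) rfl hj'

end Substitute

/-! ### Desubstitution, minimality and recurrence -/

section Generated

variable {A : Type*} [TopologicalSpace A] {L : ℕ} {θ : A → Fin L → A}

lemma continuous_substitute [DiscreteTopology A] (hL : 0 < L) :
    Continuous (substitute θ) := by
  refine continuous_pi fun i => ?_
  simp only [substitute_apply θ hL]
  exact (continuous_of_discreteTopology
    (f := fun a => θ a ⟨(i % L).toNat, toNat_emod_lt hL i⟩)).comp (continuous_apply (i / (L : ℤ)))

/-- The subshift of all shifts of images of points of `X` under the substitution. -/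
def imageSubshift [Finite A] [DiscreteTopology A] (hL : 0 < L) (θ : A → Fin L → A)
    (X : Subshift A ℤ) : Subshift A ℤ where
  carrier := {x | ∃ s : ℕ, s < L ∧ ∃ y ∈ X.carrier, x = shift (s : ℤ) (substitute θ y)}
  isClosed := by
    have h : {x | ∃ s : ℕ, s < L ∧ ∃ y ∈ X.carrier, x = shift (s : ℤ) (substitute θ y)} =
        ⋃ s ∈ Set.Iio L, (fun y => shift (s : ℤ) (substitute θ y)) '' X.carrier := by
      ext x
      simp [eq_comm]
    rw [h]
    refine (Set.finite_Iio L).isClosed_biUnion fun s _ => ?_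
    exact (X.isClosed.isCompact.image
      ((continuous_shift _).comp (continuous_substitute hL))).isClosed
  mapsTo := by
    rintro g x ⟨s, hs, y, hy, rfl⟩
    refine ⟨((s + g) % L).toNat, toNat_emod_lt hL _, shift ((s + g) / L) y, X.mapsTo _ hy, ?_⟩
    rw [substitute_shift θ hL, shift_shift, shift_shift,
      Int.toNat_of_nonneg (Int.emod_nonneg _ (by positivity)), mul_comm, Int.mul_ediv_add_emod]

lemma appears_iteratedWord_zero (hθ : IsPrimitive θ) (hL : 0 < L) {X : Subshift A ℤ}
    (hX : AllIteratesAppear θ X) (a : A) : Appears (iteratedWord θ 0 a) X := by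
  obtain ⟨m, hm, h⟩ := hθ.exists_pos_forall_exists hL
  obtain ⟨j, hj, hja⟩ := h (fun _ => a) a
  obtain ⟨x, hx, hxj⟩ := (appears_iteratedWord_iff θ hL m a X).1 (hX a m hm)
  refine (appears_iteratedWord_iff θ hL 0 a X).2 ⟨shift j x, X.mapsTo _ hx, fun i hi => ?_⟩
  obtain rfl : i = 0 := by simpa using hi
  simp [hxj j hj, hja]

/-- This is what yields desubstitution: the generated subshift lies in every such subshift, hence in
the image subshift. -/
lemma AllIteratesAppear.imageSubshift [Finite A] [DiscreteTopology A] (hθ : IsPrimitive θ)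
    (hL : 0 < L) {X : Subshift A ℤ} (hX : AllIteratesAppear θ X) :
    AllIteratesAppear θ (imageSubshift hL θ X) := by
  intro a i hi
  obtain ⟨i, rfl⟩ := Nat.exists_eq_add_of_le' hi
  have h : Appears (iteratedWord θ i a) X := by
    rcases Nat.eq_zero_or_pos i with rfl | hi
    · exact appears_iteratedWord_zero hθ hL hX a
    · exact hX a i hi
  obtain ⟨x, hx, hxj⟩ := (appears_iteratedWord_iff θ hL i a X).1 h
  refine (appears_iteratedWord_iff θ hL (i + 1) a _).2
    ⟨substitute θ x, ⟨0, hL, x, hx, by simp⟩, fun j hj => ?_⟩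
  rw [Function.iterate_succ_apply']
  apply substitute_congr θ hL
  rw [← Int.natCast_ediv]
  exact hxj _ (Nat.div_lt_of_lt_mul (by rwa [← pow_succ']))

/-- Desubstituting `i + m` times, `θ ^ m (y)` contains the letter `a`, so `x` contains `θ ^ i (a)`.
This is the source of minimality. -/
lemma allIteratesAppear_of_mem (hθ : IsPrimitive θ) (hL : 0 < L) {x : ℤ → A}
    (hx : ∀ k : ℕ, ∃ (s : ℤ) (y : ℤ → A), x = shift s ((substitute θ)^[k] y))
    {X : Subshift A ℤ} (hX : x ∈ X.carrier) : AllIteratesAppear θ X := by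
  intro a i _
  obtain ⟨m, hm, h⟩ := hθ.exists_pos_forall_exists hL
  obtain ⟨s, y, rfl⟩ := hx (i + m)
  obtain ⟨j, hj, hja⟩ := h y a
  refine (appears_iteratedWord_iff θ hL i a X).2
    ⟨shift (j * (L : ℤ) ^ i - s) _, X.mapsTo _ hX, fun t ht => ?_⟩
  rw [shift_shift, add_sub_cancel, shift_apply, Function.iterate_add_apply,
    iterate_substitute_mul_add θ hL i _ _ ht, hja]

lemma generatedSubshift_subset {X : Subshift A ℤ} (hX : AllIteratesAppear θ X) :
    (generatedSubshift θ).carrier ⊆ X.carrier := fun _ hx => hx X hX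

lemma allIteratesAppear_univ (hL : 0 < L) :
    AllIteratesAppear θ (⟨Set.univ, isClosed_univ, fun _ _ _ => trivial⟩ : Subshift A ℤ) :=
  fun a i _ => (appears_iteratedWord_iff θ hL i a _).2 ⟨_, trivial, fun _ _ => rfl⟩

variable [Finite A] [DiscreteTopology A]

/-- Here `y` is arbitrary: the images start from the full shift, since it is not yet known that the
iterates appear in the generated subshift itself. -/
lemma exists_eq_shift_iterate (hθ : IsPrimitive θ) (hL : 0 < L) (k : ℕ) :
    ∀ x ∈ (generatedSubshift θ).carrier, ∃ s : ℕ, s < L ^ k ∧ ∃ y : ℤ → A,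
      x = shift (s : ℤ) ((substitute θ)^[k] y) := by
  suffices ∃ Y : Subshift A ℤ, AllIteratesAppear θ Y ∧ ∀ x ∈ Y.carrier,
      ∃ s : ℕ, s < L ^ k ∧ ∃ y : ℤ → A, x = shift (s : ℤ) ((substitute θ)^[k] y) by
    obtain ⟨Y, hY, h⟩ := this
    exact fun x hx => h x (generatedSubshift_subset hY hx)
  induction k with
  | zero => exact ⟨_, allIteratesAppear_univ hL, fun x _ => ⟨0, by simp, x, by simp⟩⟩
  | succ k ih =>
    obtain ⟨Y, hY, h⟩ := ih
    refine ⟨imageSubshift hL θ Y, hY.imageSubshift hθ hL, ?_⟩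
    rintro _ ⟨s, hs, y, hy, rfl⟩
    obtain ⟨t, ht, z, rfl⟩ := h y hy
    refine ⟨s + t * L, ?_, z, ?_⟩
    · calc s + t * L < (t + 1) * L := by rw [add_mul]; omega
        _ ≤ L ^ k * L := Nat.mul_le_mul_right _ ht
        _ = _ := (pow_succ _ _).symm
    · rw [substitute_shift θ hL, shift_shift, Function.iterate_succ_apply']
      push_cast
      rw [add_comm]

/-- Minimality: a subshift that contains a point of the generated subshift contains all of it. -/
lemma generatedSubshift_subset_of_mem (hθ : IsPrimitive θ) (hL : 0 < L) {x : ℤ → A}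
    (hx : x ∈ (generatedSubshift θ).carrier) {X : Subshift A ℤ} (hX : x ∈ X.carrier) :
    (generatedSubshift θ).carrier ⊆ X.carrier := by
  refine generatedSubshift_subset (allIteratesAppear_of_mem hθ hL (fun k => ?_) hX)
  obtain ⟨s, -, y, h⟩ := exists_eq_shift_iterate hθ hL k x hx
  exact ⟨s, y, h⟩

/-- Desubstitution: every point of the generated subshift is a shift of `θ ^ k (y)` for some `y`
in the generated subshift. -/
lemma exists_eq_shift_iterate_substitute (hθ : IsPrimitive θ) (hL : 0 < L) (k : ℕ) {x : ℤ → A}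
    (hx : x ∈ (generatedSubshift θ).carrier) : ∃ s : ℕ, s < L ^ k ∧
      ∃ y ∈ (generatedSubshift θ).carrier, x = shift (s : ℤ) ((substitute θ)^[k] y) := by
  have hX : AllIteratesAppear θ (generatedSubshift θ) := by
    refine allIteratesAppear_of_mem hθ hL (fun k => ?_) hx
    obtain ⟨s, -, y, h⟩ := exists_eq_shift_iterate hθ hL k x hx
    exact ⟨s, y, h⟩
  induction k with
  | zero => exact ⟨0, by simp, x, hx, by simp⟩
  | succ k ih =>
    obtain ⟨t, ht, z, hz, rfl⟩ := ih
    obtain ⟨s, hs, y, hy, rfl⟩ := generatedSubshift_subset (hX.imageSubshift hθ hL) hz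
    refine ⟨t + s * L ^ k, ?_, y, hy, ?_⟩
    · calc t + s * L ^ k < (s + 1) * L ^ k := by rw [add_mul]; omega
        _ ≤ L * L ^ k := Nat.mul_le_mul_right _ hs
        _ = _ := (pow_succ' _ _).symm
    · rw [iterate_substitute_shift θ hL, shift_shift, Function.iterate_succ_apply]
      push_cast
      rw [add_comm]

/-- Syndetic recurrence: an open set that meets the generated subshift is visited by every orbit
with bounded gaps. -/
lemma exists_syndetic (hθ : IsPrimitive θ) (hL : 0 < L) {U : Set (ℤ → A)} (hU : IsOpen U)
    {x₀ : ℤ → A} (hx₀ : x₀ ∈ (generatedSubshift θ).carrier) (hxU : x₀ ∈ U) :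
    ∃ G : ℕ, ∀ x ∈ (generatedSubshift θ).carrier, ∃ g : ℕ, g < G ∧ shift (g : ℤ) x ∈ U := by
  have hopen : ∀ g : ℤ, IsOpen (shift g ⁻¹' U) := fun g => hU.preimage (continuous_shift g)
  have hcover : (generatedSubshift θ).carrier ⊆ ⋃ g : ℤ, shift g ⁻¹' U := by
    intro x hx
    by_contra hxn
    -- The points whose orbit avoids `U` form a subshift; by minimality it would contain `x₀`.
    let Y : Subshift A ℤ :=
      { carrier := (⋃ g : ℤ, shift g ⁻¹' U)ᶜ
        isClosed := (isOpen_iUnion hopen).isClosed_compl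
        mapsTo := by
          intro h y hy hy'
          obtain ⟨g, hg⟩ := Set.mem_iUnion.1 hy'
          refine hy (Set.mem_iUnion.2 ⟨h + g, ?_⟩)
          rwa [Set.mem_preimage, shift_shift] at hg }
    exact generatedSubshift_subset_of_mem hθ hL hx (X := Y) hxn hx₀
      (Set.mem_iUnion.2 ⟨0, by simpa using hxU⟩)
  obtain ⟨t, ht⟩ := (generatedSubshift θ).isClosed.isCompact.elim_finite_subcover _ hopen hcover
  -- Starting from `shift N x` turns the signed times `g` into times `N + g` in `[0, 2 * N]`.
  let N := ∑ g ∈ t, g.natAbs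
  refine ⟨2 * N + 1, fun x hx => ?_⟩
  obtain ⟨g, hg⟩ := Set.mem_iUnion.1 (ht ((generatedSubshift θ).mapsTo (N : ℤ) hx))
  obtain ⟨hgt, hg⟩ := Set.mem_iUnion.1 hg
  have hgN : g.natAbs ≤ N := Finset.single_le_sum (f := Int.natAbs) (fun _ _ => Nat.zero_le _) hgt
  refine ⟨(N + g).toNat, by omega, ?_⟩
  rw [Int.toNat_of_nonneg (by omega)]
  rwa [Set.mem_preimage, shift_shift] at hg

end Generated

/-! ### Birkhoff sums and block means -/

/-- The sum of `f` along the first `n` points of the shift orbit of `x`. -/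
def shiftSum {A : Type*} (f : (ℤ → A) → ℝ) (x : ℤ → A) (n : ℕ) : ℝ :=
  ∑ i ∈ Finset.range n, f (shift (i : ℤ) x)

/-- `f x` depends only on the coordinates of `x` in `[-r, r]`. -/
def IsLocal {A β : Type*} (f : (ℤ → A) → β) (r : ℕ) : Prop :=
  ∀ x y : ℤ → A, (∀ i : ℤ, |i| ≤ r → x i = y i) → f x = f y

/-- The averages of `f` along shift orbits of points of `X` converge to `d`. -/
def HasMean {A : Type*} (f : (ℤ → A) → ℝ) (X : Set (ℤ → A)) (d : ℝ) : Prop :=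
  ∀ x ∈ X, Tendsto (fun n : ℕ => shiftSum f x n / n) atTop (𝓝 d)

section ShiftSum

variable {A : Type*} (f : (ℤ → A) → ℝ)

lemma shiftSum_add (x : ℤ → A) (m n : ℕ) :
    shiftSum f x (m + n) = shiftSum f x m + shiftSum f (shift (m : ℤ) x) n := by
  simp only [shiftSum, Finset.sum_range_add, shift_shift, Nat.cast_add]

variable {f} in
lemma abs_shiftSum_le {C : ℝ} (hC : ∀ x, |f x| ≤ C) (x : ℤ → A) (n : ℕ) :
    |shiftSum f x n| ≤ n * C := by
  refine (Finset.abs_sum_le_sum_abs _ _).trans ?_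
  refine (Finset.sum_le_card_nsmul _ _ C fun i _ => hC _).trans ?_
  simp

variable {L : ℕ} (θ : A → Fin L → A)

lemma shiftSum_iterate_substitute_mul (hL : 0 < L) (n q : ℕ) (x : ℤ → A) :
    shiftSum f ((substitute θ)^[n] x) (q * L ^ n) =
      ∑ j ∈ Finset.range q, shiftSum f ((substitute θ)^[n] (shift (j : ℤ) x)) (L ^ n) := by
  induction q with
  | zero => simp [shiftSum]
  | succ q ih =>
    rw [Finset.sum_range_succ, ← ih, add_mul, one_mul, shiftSum_add,
      iterate_substitute_shift θ hL]
    push_cast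
    rfl

/-- The average of `f` over the block `θ ^ n (x 0)` at the origin of `θ ^ n (x)`. -/
noncomputable def blockMean (n : ℕ) (x : ℤ → A) : ℝ :=
  shiftSum f ((substitute θ)^[n] x) (L ^ n) / (L : ℝ) ^ n

lemma shiftSum_eq_sum_blockMean (hL : 0 < L) (n q : ℕ) (x : ℤ → A) :
    shiftSum f ((substitute θ)^[n] x) (q * L ^ n) =
      (∑ j ∈ Finset.range q, blockMean f θ n (shift (j : ℤ) x)) * (L : ℝ) ^ n := by
  rw [shiftSum_iterate_substitute_mul f θ hL, Finset.sum_mul]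
  refine Finset.sum_congr rfl fun j _ => ?_
  rw [blockMean, div_mul_cancel₀]
  positivity

lemma blockMean_add (hL : 0 < L) (n m : ℕ) (x : ℤ → A) :
    blockMean f θ (n + m) x = (∑ j ∈ Finset.range (L ^ m),
      blockMean f θ n (shift (j : ℤ) ((substitute θ)^[m] x))) / (L : ℝ) ^ m := by
  have hL' : (L : ℝ) ≠ 0 := by positivity
  rw [blockMean, Function.iterate_add_apply, pow_add, mul_comm, shiftSum_eq_sum_blockMean f θ hL,
    pow_add]
  field_simp

variable {f}

/-- Up to an error from the two ends, a block sum depends only on the letter it comes from. -/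
lemma shiftSum_sub_le (hL : 0 < L) {r : ℕ} (hf : IsLocal f r) {C : ℝ} (hC : ∀ x, |f x| ≤ C)
    (n : ℕ) {x y : ℤ → A} (h : x 0 = y 0) :
    shiftSum f ((substitute θ)^[n] x) (L ^ n) - shiftSum f ((substitute θ)^[n] y) (L ^ n) ≤
      4 * r * C := by
  have hC0 : 0 ≤ C := (abs_nonneg _).trans (hC x)
  rw [shiftSum, shiftSum, ← Finset.sum_sub_distrib]
  -- Only the `r` positions at each end see outside the block, and each costs at most `2 * C`.
  have key : ∀ i ∈ Finset.range (L ^ n), f (shift (i : ℤ) ((substitute θ)^[n] x)) -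
      f (shift (i : ℤ) ((substitute θ)^[n] y)) ≤
      if i ∈ Finset.range r ∪ Finset.Ico (L ^ n - r) (L ^ n) then 2 * C else 0 := by
    intro i hi
    rw [Finset.mem_range] at hi
    split_ifs with hir
    · have h₁ := abs_le.1 (hC (shift (i : ℤ) ((substitute θ)^[n] x)))
      have h₂ := abs_le.1 (hC (shift (i : ℤ) ((substitute θ)^[n] y)))
      linarith
    · simp only [Finset.mem_union, Finset.mem_range, Finset.mem_Ico, not_or] at hir
      refine (sub_eq_zero.2 (hf _ _ fun t ht => ?_)).le
      have ht := abs_le.1 ht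
      obtain ⟨s, hs⟩ := Int.eq_ofNat_of_zero_le (show (0 : ℤ) ≤ i + t by omega)
      rw [shift_apply, shift_apply, hs]
      exact iterate_substitute_block θ hL n h (by omega)
  refine (Finset.sum_le_sum key).trans ?_
  rw [← Finset.sum_filter, Finset.sum_const, nsmul_eq_mul]
  have hcard : ((Finset.range (L ^ n)).filter
      (· ∈ Finset.range r ∪ Finset.Ico (L ^ n - r) (L ^ n))).card ≤ 2 * r := by
    refine (Finset.card_le_card (fun i hi => (Finset.mem_filter.1 hi).2)).trans ?_
    refine (Finset.card_union_le _ _).trans ?_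
    rw [Finset.card_range, Nat.card_Ico]
    omega
  calc _ ≤ ((2 * r : ℕ) : ℝ) * (2 * C) := by gcongr
    _ = _ := by push_cast; ring

lemma blockMean_sub_le (hL : 0 < L) {r : ℕ} (hf : IsLocal f r) {C : ℝ} (hC : ∀ x, |f x| ≤ C)
    (n : ℕ) {x y : ℤ → A} (h : x 0 = y 0) :
    blockMean f θ n x - blockMean f θ n y ≤ 4 * r * C / (L : ℝ) ^ n := by
  rw [blockMean, blockMean, ← sub_div]
  gcongr
  exact shiftSum_sub_le θ hL hf hC n h

/-- One contraction step for the oscillation of block means. -/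
lemma blockMean_add_sub_le (hL : 0 < L) {m n : ℕ} {w e : ℝ}
    (hm : ∀ x : ℤ → A, ∀ b : A, ∃ j : ℕ, j < L ^ m ∧ (substitute θ)^[m] x j = b)
    (he : ∀ x y : ℤ → A, x 0 = y 0 → blockMean f θ n x - blockMean f θ n y ≤ e)
    (hw : ∀ x y : ℤ → A, blockMean f θ n x - blockMean f θ n y ≤ w) (x y : ℤ → A) :
    blockMean f θ (n + m) x - blockMean f θ (n + m) y ≤
      (1 - ((L : ℝ) ^ m)⁻¹) * w + ((L : ℝ) ^ m)⁻¹ * e := by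
  obtain ⟨i, hi, hxi⟩ := hm x (x 0)
  obtain ⟨j, hj, hyj⟩ := hm y (x 0)
  -- The swap pairs the two occurrences of the common letter `x 0`; that pair costs `e`, and every
  -- other pair at most `w`.
  have hperm : ∑ t ∈ Finset.range (L ^ m),
      blockMean f θ n (shift (t : ℤ) ((substitute θ)^[m] y)) = ∑ t ∈ Finset.range (L ^ m),
      blockMean f θ n (shift ((Equiv.swap i j t : ℕ) : ℤ) ((substitute θ)^[m] y)) := by
    refine (Equiv.Perm.sum_comp (Equiv.swap i j) _
      (fun t : ℕ => blockMean f θ n (shift (t : ℤ) ((substitute θ)^[m] y))) fun t ht => ?_).symm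
    by_contra htn
    rw [Finset.mem_coe, Finset.mem_range] at htn
    exact ht (Equiv.swap_apply_of_ne_of_ne (by rintro rfl; exact htn hi)
      (by rintro rfl; exact htn hj))
  rw [blockMean_add f θ hL, blockMean_add f θ hL, hperm, ← sub_div, ← Finset.sum_sub_distrib,
    ← Finset.add_sum_erase _ _ (Finset.mem_range.2 hi)]
  have h₁ : blockMean f θ n (shift (i : ℤ) ((substitute θ)^[m] x)) -
      blockMean f θ n (shift ((Equiv.swap i j i : ℕ) : ℤ) ((substitute θ)^[m] y)) ≤ e := by
    apply he
    simp [hxi, hyj]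
  have h₂ := Finset.sum_le_card_nsmul ((Finset.range (L ^ m)).erase i)
    (fun t => blockMean f θ n (shift (t : ℤ) ((substitute θ)^[m] x)) -
      blockMean f θ n (shift ((Equiv.swap i j t : ℕ) : ℤ) ((substitute θ)^[m] y))) w
    (fun t _ => hw _ _)
  rw [Finset.card_erase_of_mem (Finset.mem_range.2 hi), Finset.card_range, nsmul_eq_mul,
    Nat.cast_sub (Nat.one_le_pow _ _ hL), Nat.cast_pow, Nat.cast_one] at h₂
  have hpos : (0 : ℝ) < (L : ℝ) ^ m := by positivity
  rw [div_le_iff₀ hpos]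
  calc _ ≤ e + ((L : ℝ) ^ m - 1) * w := add_le_add h₁ h₂
    _ = _ := by field_simp; ring

/-- The block means of a bounded local function become independent of the block. -/
lemma exists_blockMean_sub_le (hL : 2 ≤ L) (hθ : IsPrimitive θ) {r : ℕ} (hf : IsLocal f r)
    {C : ℝ} (hC : ∀ x, |f x| ≤ C) {ε : ℝ} (hε : 0 < ε) :
    ∃ n : ℕ, ∀ x y : ℤ → A, blockMean f θ n x - blockMean f θ n y ≤ ε := by
  have hL0 : 0 < L := by omega
  have hL1 : (1 : ℝ) < L := by exact_mod_cast hL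
  obtain ⟨m, hm1, hm⟩ := hθ.exists_pos_forall_exists hL0
  obtain ⟨n₀, hn₀⟩ : ∃ n₀ : ℕ, ∀ n ≥ n₀, 4 * r * C / (L : ℝ) ^ n ≤ ε / 2 := by
    have h : Tendsto (fun n : ℕ => 4 * r * C / (L : ℝ) ^ n) atTop (𝓝 0) :=
      tendsto_const_nhds.div_atTop (tendsto_pow_atTop_atTop_of_one_lt hL1)
    exact eventually_atTop.1 (h.eventually_le_const (half_pos hε))
  have hbound : ∀ x, |blockMean f θ n₀ x| ≤ C := by
    intro x
    rw [blockMean, abs_div, abs_of_nonneg (by positivity : (0 : ℝ) ≤ (L : ℝ) ^ n₀),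
      div_le_iff₀ (by positivity)]
    refine (abs_shiftSum_le hC _ _).trans_eq ?_
    push_cast
    ring
  set δ : ℝ := ((L : ℝ) ^ m)⁻¹ with hδ
  have hδ0 : 0 < δ := by positivity
  have hδ1 : δ ≤ 1 := inv_le_one_of_one_le₀ (one_le_pow₀ hL1.le)
  -- `ε / 2` is the fixed point of `w ↦ (1 - δ) * w + δ * (ε / 2)`, so only the excess over it
  -- contracts.
  have main : ∀ t : ℕ, ∀ x y : ℤ → A,
      blockMean f θ (n₀ + t * m) x - blockMean f θ (n₀ + t * m) y ≤
        (1 - δ) ^ t * (2 * C) + ε / 2 := by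
    intro t
    induction t with
    | zero =>
      intro x y
      have h₁ := abs_le.1 (hbound x)
      have h₂ := abs_le.1 (hbound y)
      simp only [zero_mul, add_zero, pow_zero, one_mul]
      linarith
    | succ t ih =>
      intro x y
      have e : n₀ + (t + 1) * m = n₀ + t * m + m := by ring
      rw [e]
      refine (blockMean_add_sub_le θ hL0 hm (e := ε / 2) (fun x y hxy =>
        (blockMean_sub_le θ hL0 hf hC _ hxy).trans (hn₀ _ (by omega))) ih x y).trans_eq ?_
      rw [← hδ]
      ring
  have hlim : Tendsto (fun t : ℕ => (1 - δ) ^ t * (2 * C)) atTop (𝓝 0) := by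
    have := (tendsto_pow_atTop_nhds_zero_of_lt_one (by linarith : 0 ≤ 1 - δ)
      (by linarith : 1 - δ < 1)).mul_const (2 * C)
    simpa using this
  obtain ⟨t, ht⟩ := (hlim.eventually_le_const (half_pos hε)).exists
  exact ⟨n₀ + t * m, fun x y => (main t x y).trans (by linarith)⟩

end ShiftSum

/-! ### Unique ergodicity -/

section Mean

variable {A : Type*} [Finite A] [TopologicalSpace A] [DiscreteTopology A] {L : ℕ}
  {θ : A → Fin L → A} {f : (ℤ → A) → ℝ}

/-- A long stretch is a union of level-`n` blocks, all of nearly the same mean, plus two bounded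
ends. Here `c` may depend on `ε` but not on `x`. -/
lemma exists_eventually_abs_sub_le (hL : 2 ≤ L) (hθ : IsPrimitive θ) {r : ℕ} (hf : IsLocal f r)
    {C : ℝ} (hC : ∀ x, |f x| ≤ C) {ε : ℝ} (hε : 0 < ε) :
    ∃ c : ℝ, ∀ x ∈ (generatedSubshift θ).carrier,
      ∀ᶠ N : ℕ in atTop, |shiftSum f x N / N - c| ≤ ε := by
  rcases isEmpty_or_nonempty (ℤ → A) with hA | ⟨⟨x₀⟩⟩
  · exact ⟨0, fun x => (hA.false x).elim⟩
  have hL0 : 0 < L := by omega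
  obtain ⟨n, hn⟩ := exists_blockMean_sub_le θ hL hθ hf hC (half_pos hε)
  set c := blockMean f θ n x₀ with hc
  refine ⟨c, fun x hx => ?_⟩
  have hpos : 0 < L ^ n := by positivity
  obtain ⟨s, hs, y, -, rfl⟩ := exists_eq_shift_iterate_substitute hθ hL0 n hx
  have hC0 : 0 ≤ C := (abs_nonneg _).trans (hC y)
  set z := (substitute θ)^[n] y with hz
  have hq : ∀ q : ℕ, |shiftSum f z (q * L ^ n) - (q * L ^ n : ℕ) * c| ≤
      (q * L ^ n : ℕ) * (ε / 2) := by
    intro q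
    have h : ∀ j ∈ Finset.range q, |blockMean f θ n (shift (j : ℤ) y) - c| ≤ ε / 2 := by
      intro j _
      rw [abs_le]
      have h₁ := hn (shift (j : ℤ) y) x₀
      have h₂ := hn x₀ (shift (j : ℤ) y)
      constructor <;> linarith
    have h' := (Finset.abs_sum_le_sum_abs _ _).trans (Finset.sum_le_card_nsmul _ _ _ h)
    rw [Finset.sum_sub_distrib, Finset.sum_const, Finset.card_range, nsmul_eq_mul,
      nsmul_eq_mul] at h'
    rw [hz, shiftSum_eq_sum_blockMean f θ hL0]
    have hLn : (0 : ℝ) ≤ (L : ℝ) ^ n := by positivity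
    calc _ = |(∑ j ∈ Finset.range q, blockMean f θ n (shift (j : ℤ) y) - q * c) * (L : ℝ) ^ n| := by
          congr 1; push_cast; ring
      _ = |∑ j ∈ Finset.range q, blockMean f θ n (shift (j : ℤ) y) - q * c| * (L : ℝ) ^ n := by
          rw [abs_mul, abs_of_nonneg hLn]
      _ ≤ q * (ε / 2) * (L : ℝ) ^ n := by gcongr
      _ = _ := by push_cast; ring
  set D : ℝ := (L ^ n : ℕ) * (2 * C + |c| + ε / 2) + (L ^ n : ℕ) * |c| with hD
  have hN : ∀ N : ℕ, |shiftSum f (shift (s : ℤ) z) N - N * c| ≤ N * (ε / 2) + D := by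
    intro N
    set q := (s + N) / L ^ n with hqdef
    set t := (s + N) % L ^ n with htdef
    have hqt : s + N = q * L ^ n + t := by rw [mul_comm]; exact (Nat.div_add_mod _ _).symm
    have ht : t < L ^ n := Nat.mod_lt _ hpos
    have e₁ := shiftSum_add f z s N
    have e₂ := shiftSum_add f z (q * L ^ n) t
    rw [← hqt, e₁] at e₂
    have b₁ := abs_le.1 (abs_shiftSum_le hC z s)
    have b₂ := abs_le.1 (abs_shiftSum_le hC (shift ((q * L ^ n : ℕ) : ℤ) z) t)
    have b₃ := abs_le.1 (hq q)
    have ht' : (t : ℝ) ≤ (L ^ n : ℕ) := by exact_mod_cast ht.le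
    have hs' : (s : ℝ) ≤ (L ^ n : ℕ) := by exact_mod_cast hs.le
    have hqt' : ((q * L ^ n : ℕ) : ℝ) = s + N - t := by
      have : ((s + N : ℕ) : ℝ) = ((q * L ^ n + t : ℕ) : ℝ) := by rw [hqt]
      push_cast at this ⊢
      linarith
    rw [hqt'] at b₃
    have c₁ : (s : ℝ) * C ≤ (L ^ n : ℕ) * C := by gcongr
    have c₂ : (t : ℝ) * C ≤ (L ^ n : ℕ) * C := by gcongr
    have c₃ : (s : ℝ) * (ε / 2) ≤ (L ^ n : ℕ) * (ε / 2) := by gcongr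
    have c₄ : 0 ≤ (t : ℝ) * (ε / 2) := by positivity
    have c₅ := abs_le.1 (show |(s : ℝ) * c| ≤ (L ^ n : ℕ) * |c| by
      rw [abs_mul, Nat.abs_cast]; gcongr)
    have c₆ := abs_le.1 (show |(t : ℝ) * c| ≤ (L ^ n : ℕ) * |c| by
      rw [abs_mul, Nat.abs_cast]; gcongr)
    rw [abs_le]
    constructor <;> linarith
  have hlim : Tendsto (fun N : ℕ => D / N) atTop (𝓝 0) := tendsto_const_div_atTop_nhds_zero_nat D
  filter_upwards [hlim.eventually_le_const (half_pos hε), eventually_gt_atTop 0] with N h₁ h₂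
  have hN0 : (0 : ℝ) < N := by exact_mod_cast h₂
  have e : shiftSum f (shift (s : ℤ) z) N / N - c =
      (shiftSum f (shift (s : ℤ) z) N - N * c) / N := by field_simp
  rw [e, abs_div, Nat.abs_cast, div_le_iff₀ hN0]
  rw [div_le_iff₀ hN0] at h₁
  linarith [hN N]

/-- Unique ergodicity of the generated subshift, for local functions. -/
theorem exists_hasMean (hL : 2 ≤ L) (hθ : IsPrimitive θ) {r : ℕ} (hf : IsLocal f r)
    {C : ℝ} (hC : ∀ x, |f x| ≤ C) : ∃ d, HasMean f (generatedSubshift θ).carrier d := by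
  rcases (generatedSubshift θ).carrier.eq_empty_or_nonempty with h | ⟨x₀, hx₀⟩
  · exact ⟨0, fun x hx => by simp [h] at hx⟩
  have key : ∀ ε > 0, ∃ c : ℝ, ∀ x ∈ (generatedSubshift θ).carrier,
      ∀ᶠ N : ℕ in atTop, |shiftSum f x N / N - c| ≤ ε :=
    fun ε hε => exists_eventually_abs_sub_le hL hθ hf hC hε
  have hcauchy : CauchySeq (fun N : ℕ => shiftSum f x₀ N / N) := by
    refine Metric.cauchySeq_iff'.2 fun ε hε => ?_
    obtain ⟨c, hc⟩ := key (ε / 3) (by positivity)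
    obtain ⟨N, hN⟩ := eventually_atTop.1 (hc x₀ hx₀)
    refine ⟨N, fun n hn => ?_⟩
    have h₁ := abs_le.1 (hN n hn)
    have h₂ := abs_le.1 (hN N le_rfl)
    rw [Real.dist_eq, abs_lt]
    constructor <;> linarith
  obtain ⟨d, hd⟩ := cauchySeq_tendsto_of_complete hcauchy
  refine ⟨d, fun x hx => ?_⟩
  refine Metric.tendsto_nhds.2 fun ε hε => ?_
  obtain ⟨c, hc⟩ := key (ε / 4) (by positivity)
  filter_upwards [hc x hx, hc x₀ hx₀,
    Metric.tendsto_nhds.1 hd (ε / 4) (by positivity)] with N h₁ h₂ h₃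
  rw [Real.dist_eq] at h₃ ⊢
  rw [abs_le] at h₁ h₂
  rw [abs_lt] at h₃ ⊢
  constructor <;> linarith

end Mean

/-! ### Repetitions and frequencies of long words -/

lemma exists_pow_between {M : ℕ} (hM : 2 ≤ M) {n : ℕ} (hn : 1 ≤ n) :
    ∃ j, n ≤ M ^ j ∧ M ^ j ≤ M * n := by
  rcases hn.eq_or_lt with rfl | hn
  · exact ⟨0, by simp, by simp; omega⟩
  · have hc : Nat.clog M n ≠ 0 := (Nat.clog_pos (by omega) (by omega)).ne'
    obtain ⟨t, ht⟩ := Nat.exists_eq_succ_of_ne_zero hc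
    refine ⟨Nat.clog M n, Nat.le_pow_clog (by omega) n, ?_⟩
    have := Nat.pow_pred_clog_lt_self (b := M) (by omega) hn
    rw [ht] at this ⊢
    rw [pow_succ']
    exact Nat.mul_le_mul_left _ this.le

open scoped Classical in
/-- The number of visits of `x, σ x, …, σ ^ (n - 1) x` to `E`. -/
noncomputable def visits {A : Type*} (E : Set (ℤ → A)) (x : ℤ → A) (n : ℕ) : ℕ :=
  ((Finset.range n).filter fun i : ℕ => shift (i : ℤ) x ∈ E).card

lemma shiftSum_indicator {A : Type*} (E : Set (ℤ → A)) (x : ℤ → A) (n : ℕ) :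
    shiftSum (E.indicator 1) x n = visits E x n := by
  classical
  simp only [shiftSum, visits, Set.indicator_apply, Pi.one_apply, Finset.sum_boole]

/-- The points that agree with `x` on `[0, n)`. -/
def prefixSet {A : Type*} (x : ℤ → A) (n : ℕ) : Set (ℤ → A) := {y | ∀ t : ℕ, t < n → y t = x t}

section

variable {A : Type*} [Finite A] [TopologicalSpace A] [DiscreteTopology A] {L : ℕ}
  {θ : A → Fin L → A}

omit [Finite A] in
lemma isOpen_prefixSet (x : ℤ → A) (n : ℕ) : IsOpen (prefixSet x n) := by
  have : prefixSet x n = ⋂ t ∈ Set.Iio n, {y : ℤ → A | y t = x t} := by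
    ext y
    simp [prefixSet]
  rw [this]
  exact (Set.finite_Iio n).isOpen_biInter fun t _ =>
    (isOpen_discrete {x (t : ℤ)}).preimage (continuous_apply (A := fun _ : ℤ => A) (t : ℤ))

/-- Two-letter words suffice later because two positions at most one block length apart lie in two
consecutive blocks. -/
lemma exists_gap_of_pairs (hθ : IsPrimitive θ) (hL : 0 < L) :
    ∃ G : ℕ, ∀ x ∈ (generatedSubshift θ).carrier, ∀ y ∈ (generatedSubshift θ).carrier,
      ∃ g : ℕ, g < G ∧ y g = x 0 ∧ y (g + 1) = x 1 := by
  have key : ∀ c : A × A, ∃ G : ℕ, ∀ x ∈ (generatedSubshift θ).carrier, x 0 = c.1 → x 1 = c.2 →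
      ∀ y ∈ (generatedSubshift θ).carrier, ∃ g : ℕ, g < G ∧ y g = x 0 ∧ y (g + 1) = x 1 := by
    intro c
    by_cases h : ∃ x ∈ (generatedSubshift θ).carrier, x 0 = c.1 ∧ x 1 = c.2
    · obtain ⟨x, hx, h0, h1⟩ := h
      obtain ⟨G, hG⟩ := exists_syndetic hθ hL (isOpen_prefixSet x 2) hx (fun _ _ => rfl)
      refine ⟨G, fun x' _ h0' h1' y hy => ?_⟩
      obtain ⟨g, hg, hgy⟩ := hG y hy
      refine ⟨g, hg, ?_, ?_⟩
      · simpa [h0', h0] using hgy 0 (by norm_num)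
      · simpa [h1', h1] using hgy 1 (by norm_num)
    · exact ⟨0, fun x hx h0 h1 => (h ⟨x, hx, h0, h1⟩).elim⟩
  choose G hG using key
  have := Fintype.ofFinite A
  refine ⟨∑ c, G c, fun x hx y hy => ?_⟩
  obtain ⟨g, hg, h⟩ := hG (x 0, x 1) x hx rfl rfl y hy
  exact ⟨g, hg.trans_le (Finset.single_le_sum (fun _ _ => Nat.zero_le _) (Finset.mem_univ _)), h⟩

omit [TopologicalSpace A] [DiscreteTopology A] in
lemma finite_of_forall_periodic {p : ℕ} (hp : 1 ≤ p) {X : Set (ℤ → A)}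
    (hX : ∀ x ∈ X, ∀ i : ℤ, x i = x (i + p)) : X.Finite := by
  have hp0 : (p : ℤ) ≠ 0 := by positivity
  refine Set.Finite.of_injOn (f := fun (x : ℤ → A) (i : Fin p) => x (i : ℕ)) (t := Set.univ)
    (fun _ _ => trivial) ?_ Set.finite_univ
  have hmod : ∀ x ∈ X, ∀ i : ℤ, x i = x (i % p) := by
    intro x hx i
    have h : ∀ q : ℤ, x (i % p + q * p) = x (i % p) := by
      have hper : Function.Periodic x p := fun i => (hX x hx i).symm
      exact fun q => hper.int_mul q (i % p)
    rw [← h (i / p), mul_comm, Int.emod_add_mul_ediv]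
  intro x hx y hy hxy
  funext i
  rw [hmod x hx, hmod y hy]
  have h := congrFun hxy ⟨(i % p).toNat, toNat_emod_lt hp i⟩
  simpa [Int.toNat_of_nonneg (Int.emod_nonneg i hp0)] using h

/-- In an infinite generated subshift, a stretch with period `p` has length at most `K * p`. -/
lemma exists_period_bound (hL : 2 ≤ L) (hθ : IsPrimitive θ)
    (hinf : (generatedSubshift θ).carrier.Infinite) :
    ∃ K : ℕ, ∀ x ∈ (generatedSubshift θ).carrier, ∀ p n : ℕ, 1 ≤ p →
      (∀ i : ℕ, i < n → x i = x (i + p)) → n ≤ K * p := by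
  have hL0 : 0 < L := by omega
  obtain ⟨G, hG⟩ := exists_gap_of_pairs hθ hL0
  refine ⟨(G + 1) * L, fun x hx p n hp hper => ?_⟩
  by_contra! hlt
  -- At this scale any two positions `p` apart lie in some `θ ^ k (a b)`, and the periodic stretch
  -- is long enough to contain the relevant part of a copy. So the period spreads to all points.
  obtain ⟨k, hk, hk'⟩ := exists_pow_between hL hp
  obtain ⟨s, hs, y, hy, rfl⟩ := exists_eq_shift_iterate_substitute hθ hL0 k hx
  refine hinf (finite_of_forall_periodic hp fun x' hx' i => ?_)
  obtain ⟨s', hs', y', hy', hxy'⟩ := exists_eq_shift_iterate_substitute hθ hL0 k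
    ((generatedSubshift θ).mapsTo i hx')
  -- The search starts at coordinate `1` of `y` so that the copy lies to the right of the cut `s`.
  obtain ⟨g, hg, hg0, hg1⟩ := hG y' hy' (shift 1 y) ((generatedSubshift θ).mapsTo 1 hy)
  rw [shift_apply] at hg0 hg1
  have hLk : (0 : ℤ) < (L : ℤ) ^ k := by positivity
  have hcopy : ∀ t : ℕ, t < 2 * L ^ k →
      (substitute θ)^[k] y ((1 + g) * (L : ℤ) ^ k + t) = (substitute θ)^[k] y' t := by
    intro t ht
    have e := congrFun (iterate_substitute_shift θ hL0 k (1 + g) y) t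
    rw [shift_apply] at e
    rw [← e]
    apply iterate_substitute_congr θ hL0
    rw [shift_apply]
    rcases lt_or_ge t (L ^ k) with h | h
    · rw [Int.ediv_eq_zero_of_lt (by positivity) (by exact_mod_cast h), add_zero, hg0]
    · have : (t : ℤ) / (L : ℤ) ^ k = 1 := by
        rw [Int.ediv_eq_iff_of_pos hLk]
        zify at h ht
        constructor <;> linarith
      rw [this, add_assoc, hg1]
  have hrun : s + (n : ℤ) > (1 + g) * (L : ℤ) ^ k + s' := by
    have : (g + 2) * L ^ k ≤ n := by
      calc (g + 2) * L ^ k ≤ (G + 1) * (L * p) := Nat.mul_le_mul (by omega) hk'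
        _ ≤ n := by rw [← mul_assoc]; exact hlt.le
    zify at this hs'
    linarith
  obtain ⟨u, hu⟩ := Int.eq_ofNat_of_zero_le (show 0 ≤ (1 + g) * (L : ℤ) ^ k + s' - s by
    zify at hs
    have : (0 : ℤ) ≤ g * (L : ℤ) ^ k := by positivity
    linarith)
  have h := hper u (by omega)
  rw [shift_apply, shift_apply] at h
  have e₁ : (s : ℤ) + u = (1 + g) * (L : ℤ) ^ k + s' := by linarith
  have e₂ : (s : ℤ) + (u + p) = (1 + g) * (L : ℤ) ^ k + (s' + p : ℕ) := by
    push_cast; linarith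
  rw [e₁, e₂, hcopy s' (by omega), hcopy (s' + p) (by omega)] at h
  have h0 := congrFun hxy' 0
  have hp' := congrFun hxy' p
  simp only [shift_apply, add_zero] at h0 hp'
  rw [h0, hp', h]
  push_cast
  rfl

omit [Finite A] [DiscreteTopology A] in
-- Two visits at distance `p` create a stretch of length `n` with period `p`, so `n ≤ K * p`. Hence
-- `i ↦ K * i / n` is injective on visit times.
lemma visits_prefixSet_le {K n : ℕ} (hn : 1 ≤ n)
    (hK : ∀ x ∈ (generatedSubshift θ).carrier, ∀ p m : ℕ, 1 ≤ p →
      (∀ i : ℕ, i < m → x i = x (i + p)) → m ≤ K * p)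
    (x₀ : ℤ → A) {x : ℤ → A} (hx : x ∈ (generatedSubshift θ).carrier) (l : ℕ) :
    visits (prefixSet x₀ n) x l ≤ K * l / n + 1 := by
  classical
  rw [← Finset.card_range (K * l / n + 1), visits]
  have hlt : ∀ i j : ℕ, i < j → shift (i : ℤ) x ∈ prefixSet x₀ n →
      shift (j : ℤ) x ∈ prefixSet x₀ n → K * i / n < K * j / n := by
    intro i j hij hi hj
    obtain ⟨p, rfl⟩ := Nat.exists_eq_add_of_lt hij
    have h := hK _ ((generatedSubshift θ).mapsTo i hx) (p + 1) n (by omega) (fun t ht => by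
      have h₁ := hi t ht
      have h₂ := hj t ht
      rw [← h₂] at h₁
      rw [h₁, shift_apply, shift_apply]
      congr 1
      push_cast
      ring)
    have : K * i / n + 1 ≤ K * (i + p + 1) / n := by
      rw [← Nat.add_div_right _ hn]
      apply Nat.div_le_div_right
      calc K * i + n ≤ K * i + K * (p + 1) := by omega
        _ = _ := by ring
    omega
  refine Finset.card_le_card_of_injOn (fun i => K * i / n) (fun i hi => ?_) ?_
  · simp only [Finset.coe_filter, Finset.mem_range, Set.mem_ofPred_eq] at hi
    simp only [Finset.coe_range, Set.mem_Iio]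
    exact Nat.lt_succ_of_le (Nat.div_le_div_right (Nat.mul_le_mul_left _ hi.1.le))
  · intro i hi j hj hij
    simp only [Finset.coe_filter, Finset.mem_range, Set.mem_ofPred_eq] at hi hj
    rcases lt_trichotomy i j with h | h | h
    · exact absurd hij (hlt i j h hi.2 hj.2).ne
    · exact h
    · exact absurd hij (hlt j i h hj.2 hi.2).ne'

/-- Each `G` consecutive steps contain a visit, so `d ≥ 1 / G`. -/
lemma HasMean.pos (hL : 2 ≤ L) (hθ : IsPrimitive θ) {E : Set (ℤ → A)} (hE : IsOpen E) {d : ℝ}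
    (hd : HasMean (E.indicator 1) (generatedSubshift θ).carrier d) {x : ℤ → A}
    (hx : x ∈ (generatedSubshift θ).carrier) (hxE : x ∈ E) : 0 < d := by
  obtain ⟨G, hG⟩ := exists_syndetic hθ (by omega) hE hx hxE
  have hG0 : 0 < G := by
    obtain ⟨g, hg, -⟩ := hG x hx
    omega
  have hge : ∀ N : ℕ, (N : ℝ) ≤ shiftSum (E.indicator 1) x (N * G) := by
    intro N
    induction N with
    | zero => simp [shiftSum]
    | succ N ih =>
      rw [add_mul, one_mul, shiftSum_add, Nat.cast_add_one]
      refine add_le_add ih ?_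
      obtain ⟨g, hg, hgE⟩ := hG _ ((generatedSubshift θ).mapsTo ((N * G : ℕ) : ℤ) hx)
      refine le_trans ?_ (Finset.single_le_sum (fun i _ => ?_) (Finset.mem_range.2 hg))
      · rw [Set.indicator_of_mem hgE]; rfl
      · exact Set.indicator_nonneg (fun _ _ => zero_le_one) _
  have hlim := (hd x hx).comp (tendsto_id.atTop_mul_const' hG0)
  have hG0' : (0 : ℝ) < G := by exact_mod_cast hG0
  refine (inv_pos.2 hG0').trans_le (ge_of_tendsto hlim ?_)
  filter_upwards [eventually_gt_atTop 0] with N hN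
  have hN0 : (0 : ℝ) < N := by exact_mod_cast hN
  simp only [Function.comp_apply, id_eq]
  rw [le_div_iff₀ (by push_cast; positivity)]
  refine le_trans ?_ (hge N)
  push_cast
  field_simp
  exact le_rfl

/-- The densities of the sets that are determined by a window comparable to `L ^ k` and are
visited a bounded number of times in each block of length `L ^ k` are `L ^ (-k)` times elements of
a fixed finite set. -/
theorem exists_finite_scaled_mean (hL : 2 ≤ L) (hθ : IsPrimitive θ)
    (hne : (generatedSubshift θ).carrier.Nonempty) (K : ℕ) :
    ∃ F : Set ℝ, F.Finite ∧ ∀ (k : ℕ) (E : Set (ℤ → A)) (d : ℝ),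
      (∀ x ∈ (generatedSubshift θ).carrier, ∀ y ∈ (generatedSubshift θ).carrier,
        (∀ i : ℤ, |i| ≤ (L : ℤ) ^ k → x i = y i) → (x ∈ E ↔ y ∈ E)) →
      (∀ x ∈ (generatedSubshift θ).carrier, visits E x (L ^ k) ≤ K) →
      HasMean (E.indicator 1) (generatedSubshift θ).carrier d → (L : ℝ) ^ k * d ∈ F := by
  have hL0 : 0 < L := by omega
  have hex : ∀ h : A × A × A → Fin (K + 1), ∃ d,
      HasMean (fun x => ((h (x (-1), x 0, x 1) : ℕ) : ℝ)) (generatedSubshift θ).carrier d := by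
    intro h
    refine exists_hasMean hL hθ (r := 1) (C := K) (fun x y hxy => ?_) fun x => ?_
    · rw [hxy (-1) (by simp), hxy 0 (by simp), hxy 1 (by simp)]
    · rw [Nat.abs_cast]
      exact_mod_cast Fin.is_le _
  choose D hD using hex
  refine ⟨Set.range D, Set.finite_range D, fun k E d hE hK hd => ?_⟩
  have hLk : (0 : ℤ) < (L : ℤ) ^ k := by positivity
  -- The hypotheses control `E` only on the subshift, so counts are read only where `θ ^ k (y)` lies
  -- in it.
  let good : (ℤ → A) → Prop := fun y => (substitute θ)^[k] y ∈ (generatedSubshift θ).carrier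
  have hcongr : ∀ y y' : ℤ → A, good y → good y' → y (-1) = y' (-1) → y 0 = y' 0 → y 1 = y' 1 →
      visits E ((substitute θ)^[k] y) (L ^ k) = visits E ((substitute θ)^[k] y') (L ^ k) := by
    intro y y' hy hy' h₁ h₂ h₃
    rw [visits, visits]
    congr 1
    ext i
    simp only [Finset.mem_filter]
    refine and_congr_right fun hi => hE _ ((generatedSubshift θ).mapsTo _ hy) _ ((generatedSubshift θ).mapsTo _ hy')
      fun t ht => ?_
    rw [shift_apply, shift_apply]
    apply iterate_substitute_congr θ hL0
    have hi := Finset.mem_range.1 hi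
    zify at hi
    have ht := abs_le.1 ht
    -- With `0 ≤ i < L ^ k` and `|t| ≤ L ^ k`, the position `i + t` stays in blocks `-1`, `0` and
    -- `1`.
    have hlow : -1 ≤ (i + t) / (L : ℤ) ^ k := by
      rw [Int.le_ediv_iff_mul_le hLk]
      linarith
    have hhigh : (i + t) / (L : ℤ) ^ k < 2 := by
      rw [Int.ediv_lt_iff_lt_mul hLk]
      linarith
    obtain h | h | h : (i + t) / (L : ℤ) ^ k = -1 ∨ (i + t) / (L : ℤ) ^ k = 0 ∨
        (i + t) / (L : ℤ) ^ k = 1 := by omega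
    all_goals rw [h]; assumption
  obtain ⟨h, hh⟩ : ∃ h : A × A × A → Fin (K + 1), ∀ y, good y →
      (h (y (-1), y 0, y 1) : ℕ) = visits E ((substitute θ)^[k] y) (L ^ k) := by
    have key : ∀ c : A × A × A, ∃ v : Fin (K + 1), ∀ y, good y → (y (-1), y 0, y 1) = c →
        (v : ℕ) = visits E ((substitute θ)^[k] y) (L ^ k) := by
      intro c
      by_cases hc : ∃ y, good y ∧ (y (-1), y 0, y 1) = c
      · obtain ⟨y, hy, hyc⟩ := hc
        refine ⟨⟨_, Nat.lt_succ_of_le (hK _ hy)⟩, fun y' hy' hyc' => ?_⟩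
        rw [← hyc] at hyc'
        simp only [Prod.mk.injEq] at hyc'
        exact (hcongr y' y hy' hy hyc'.1 hyc'.2.1 hyc'.2.2).symm
      -- Triples that come from no good point get the irrelevant value `0`.
      · exact ⟨0, fun y hy hyc => (hc ⟨y, hy, hyc⟩).elim⟩
    choose h hh using key
    exact ⟨h, fun y hy => hh _ y hy rfl⟩
  refine ⟨h, ?_⟩
  obtain ⟨x, hx⟩ := hne
  obtain ⟨s, -, y, hy, rfl⟩ := exists_eq_shift_iterate_substitute hθ hL0 k hx
  have hgood : good y := by
    have := (generatedSubshift θ).mapsTo (-s) hx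
    rwa [shift_shift, add_neg_cancel, shift_zero] at this
  have hgoods : ∀ j : ℕ, good (shift (j : ℤ) y) := by
    intro j
    simp only [good, iterate_substitute_shift θ hL0]
    exact (generatedSubshift θ).mapsTo _ hgood
  have hlim := ((hd _ hgood).comp (tendsto_id.atTop_mul_const' (pow_pos hL0 k))).const_mul
    ((L : ℝ) ^ k)
  -- The visits along `N` blocks of `θ ^ k (y)` are the sum of `h` along `N` letters of `y`; the
  -- factor `L ^ k` rescales time.
  refine tendsto_nhds_unique (hD h y hy) (hlim.congr fun N => ?_)
  simp only [Function.comp_apply, id_eq]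
  rw [shiftSum_iterate_substitute_mul _ θ hL0]
  have hsum : ∑ j ∈ Finset.range N,
      shiftSum (E.indicator 1) ((substitute θ)^[k] (shift (j : ℤ) y)) (L ^ k) =
      shiftSum (fun x => ((h (x (-1), x 0, x 1) : ℕ) : ℝ)) y N := by
    rw [shiftSum]
    refine Finset.sum_congr rfl fun j _ => ?_
    rw [shiftSum_indicator, hh _ (hgoods j)]
  rw [hsum]
  push_cast
  field_simp

end

/-! ### Conjugacies as block codes -/

section Conjugacy

variable {A : Type*} [TopologicalSpace A] {B : Type*} [TopologicalSpace B]

lemma coe_sigma_iterate (X : Subshift A ℤ) (i : ℕ) (x : X.carrier) :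
    (((sigma X)^[i] x : X.carrier) : ℤ → A) = shift (i : ℤ) x := by
  induction i with
  | zero => simp
  | succ i ih =>
    rw [Function.iterate_succ_apply']
    funext t
    change ((sigma X)^[i] x : X.carrier).1 (t + 1) = _
    rw [ih, shift_apply, shift_apply,
      show (i : ℤ) + (t + 1) = ((i + 1 : ℕ) : ℤ) + t by push_cast; ring]

/-- A continuous letter-valued function on a subshift depends on finitely many coordinates. -/
lemma exists_radius [Finite B] [DiscreteTopology B] [DiscreteTopology A] (Y : Subshift B ℤ)
    {u : Y.carrier → A} (hu : Continuous u) :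
    ∃ r : ℕ, ∀ y y' : Y.carrier, (∀ i : ℤ, |i| ≤ r → y.1 i = y'.1 i) → u y = u y' := by
  have hloc : ∀ y : Y.carrier, ∃ I : Finset ℤ, ∀ y' : Y.carrier,
      (∀ i ∈ I, y'.1 i = y.1 i) → u y' = u y := by
    intro y
    have hopen : IsOpen (u ⁻¹' {u y}) := (isOpen_discrete _).preimage hu
    obtain ⟨V, hV, hVu⟩ := isOpen_induced_iff.1 hopen
    have hyV : y.1 ∈ V := by
      have : y ∈ Subtype.val ⁻¹' V := by rw [hVu]; rfl
      exact this
    obtain ⟨I, W, hW, hWV⟩ := isOpen_pi_iff.1 hV y.1 hyV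
    refine ⟨I, fun y' hy' => ?_⟩
    have : y' ∈ Subtype.val ⁻¹' V := hWV fun i hi => by rw [hy' i hi]; exact (hW i hi).2
    rw [hVu] at this
    exact this
  choose I hI using hloc
  have hopen : ∀ y : Y.carrier, IsOpen (cylinder (I y) y.1) := fun y => isOpen_cylinder _ _
  obtain ⟨t, ht⟩ := Y.isClosed.isCompact.elim_finite_subcover _ hopen
    fun y hy => Set.mem_iUnion.2 ⟨⟨y, hy⟩, fun _ _ => rfl⟩
  refine ⟨∑ y ∈ t, ∑ i ∈ I y, i.natAbs, fun y y' h => ?_⟩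
  obtain ⟨z, hz⟩ := Set.mem_iUnion.1 (ht y.2)
  obtain ⟨hzt, hz⟩ := Set.mem_iUnion.1 hz
  rw [hI z y hz, hI z y' fun i hi => ?_]
  rw [← hz i hi]
  refine (h i ?_).symm
  have h₁ : i.natAbs ≤ ∑ i ∈ I z, i.natAbs :=
    Finset.single_le_sum (f := Int.natAbs) (fun _ _ => Nat.zero_le _) hi
  have h₂ := Finset.single_le_sum (f := fun y => ∑ i ∈ I y, i.natAbs)
    (fun _ _ => Nat.zero_le _) hzt
  have h₃ := h₁.trans h₂
  rw [Int.abs_eq_natAbs]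
  exact_mod_cast h₃

/-- Transport of a set through a map between subshifts. -/
def transport {X : Subshift A ℤ} {Y : Subshift B ℤ} (ψ : Y.carrier → X.carrier)
    (E : Set (ℤ → A)) : Set (ℤ → B) := {y | ∃ hy : y ∈ Y.carrier, (ψ ⟨y, hy⟩ : ℤ → A) ∈ E}

variable {X : Subshift A ℤ} {Y : Subshift B ℤ} {ψ : Y.carrier → X.carrier}

lemma coe_map_shift (hψ : ∀ y, ψ (sigma Y y) = sigma X (ψ y)) {y : ℤ → B} (hy : y ∈ Y.carrier)
    (i : ℕ) : (ψ ⟨shift (i : ℤ) y, Y.mapsTo _ hy⟩ : ℤ → A) = shift (i : ℤ) (ψ ⟨y, hy⟩ : ℤ → A) := by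
  have h : ψ ((sigma Y)^[i] ⟨y, hy⟩) = (sigma X)^[i] (ψ ⟨y, hy⟩) :=
    (Function.Semiconj.iterate_right (f := ψ) hψ i) ⟨y, hy⟩
  rw [← coe_sigma_iterate, ← h]
  congr 2
  exact Subtype.ext (coe_sigma_iterate Y i ⟨y, hy⟩).symm

lemma visits_transport (hψ : ∀ y, ψ (sigma Y y) = sigma X (ψ y)) (E : Set (ℤ → A))
    {y : ℤ → B} (hy : y ∈ Y.carrier) (n : ℕ) :
    visits (transport ψ E) y n = visits E (ψ ⟨y, hy⟩ : ℤ → A) n := by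
  rw [visits, visits]
  congr 1
  ext i
  simp only [Finset.mem_filter]
  refine and_congr_right fun _ => ?_
  rw [← coe_map_shift hψ hy]
  exact ⟨fun ⟨_, h⟩ => h, fun h => ⟨_, h⟩⟩

lemma HasMean.transport (hψ : ∀ y, ψ (sigma Y y) = sigma X (ψ y)) {E : Set (ℤ → A)} {d : ℝ}
    (hd : HasMean (E.indicator 1) X.carrier d) :
    HasMean ((transport ψ E).indicator 1) Y.carrier d := by
  intro y hy
  have h := hd _ (ψ ⟨y, hy⟩).2
  simpa only [shiftSum_indicator, visits_transport hψ E hy] using h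

end Conjugacy

/-! ### Multiplicative dependence and conclusion -/

/-- If the ratios `L ^ k / M ^ j k` take finitely many values, then `L` and `M` have a common
power. -/
lemma exists_pow_eq_pow_of_finite {L M : ℕ} (hL : 2 ≤ L) (hM : 2 ≤ M) {Q : Set ℝ} (hQ : Q.Finite)
    (h : ∀ k : ℕ, ∃ j : ℕ, (L : ℝ) ^ k / (M : ℝ) ^ j ∈ Q) :
    ∃ a b : ℕ, 1 ≤ a ∧ 1 ≤ b ∧ L ^ a = M ^ b := by
  choose j hj using h
  obtain ⟨k, k', hkk, he⟩ : ∃ k k' : ℕ, k < k' ∧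
      (L : ℝ) ^ k / (M : ℝ) ^ j k = (L : ℝ) ^ k' / (M : ℝ) ^ j k' := by
    obtain ⟨k, -, k', -, hne, he⟩ := Set.infinite_univ.exists_ne_map_eq_of_mapsTo
      (f := fun k : ℕ => (L : ℝ) ^ k / (M : ℝ) ^ j k) (fun k _ => hj k) hQ
    rcases hne.lt_or_gt with hlt | hlt
    · exact ⟨k, k', hlt, he⟩
    · exact ⟨k', k, hlt, he.symm⟩
  have hM0 : (M : ℝ) ≠ 0 := by positivity
  have hL0 : 0 < L := by omega
  rw [div_eq_div_iff (pow_ne_zero _ hM0) (pow_ne_zero _ hM0)] at he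
  have he' : L ^ k * M ^ j k' = L ^ k' * M ^ j k := by exact_mod_cast he
  obtain ⟨a, rfl⟩ := Nat.exists_eq_add_of_lt hkk
  rw [add_assoc k a 1, pow_add, mul_assoc, ← add_assoc k a 1] at he'
  have he := Nat.eq_of_mul_eq_mul_left (pow_pos hL0 k) he'
  have hlt : j k < j (k + a + 1) := by
    rw [← Nat.pow_lt_pow_iff_right (a := M) (by omega), he]
    exact lt_mul_of_one_lt_left (by positivity) (Nat.one_lt_pow (by omega) (by omega))
  obtain ⟨b, hb⟩ := Nat.exists_eq_add_of_lt hlt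
  refine ⟨a + 1, b + 1, by omega, by omega, ?_⟩
  rw [hb, add_assoc, pow_add, mul_comm] at he
  exact (Nat.eq_of_mul_eq_mul_right (by positivity) he).symm

/-- A Cobham-type theorem: conjugate infinite subshifts generated by primitive substitutions of
constant length have multiplicatively dependent lengths. -/
theorem exists_pow_eq_pow_of_conjugate
    {A : Type*} [Finite A] [TopologicalSpace A] [DiscreteTopology A]
    {B : Type*} [Finite B] [TopologicalSpace B] [DiscreteTopology B]
    {L M : ℕ} (hL : 2 ≤ L) (hM : 2 ≤ M) {θ : A → Fin L → A} {ζ : B → Fin M → B}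
    (hθ : IsPrimitive θ) (hζ : IsPrimitive ζ)
    (hXθ : (generatedSubshift θ).carrier.Infinite)
    (hXζ : (generatedSubshift ζ).carrier.Infinite)
    (hconj : TopologicallyConjugate (sigma (generatedSubshift θ)) (sigma (generatedSubshift ζ))) :
    ∃ a b : ℕ, 1 ≤ a ∧ 1 ≤ b ∧ L ^ a = M ^ b := by
  obtain ⟨φ, hφ⟩ := hconj
  have hψ : ∀ y, φ.symm (sigma (generatedSubshift ζ) y) =
      sigma (generatedSubshift θ) (φ.symm y) := by
    intro y
    rw [Homeomorph.symm_apply_eq]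
    simpa using (congrFun hφ (φ.symm y)).symm
  obtain ⟨x₀, hx₀⟩ := hXθ.nonempty
  obtain ⟨K, hK⟩ := exists_period_bound hL hθ hXθ
  obtain ⟨r, hr⟩ := exists_radius (generatedSubshift ζ)
    (u := fun y => (φ.symm y : ℤ → A) 0) (by
      exact (continuous_apply (0 : ℤ)).comp (continuous_subtype_val.comp φ.symm.continuous))
  obtain ⟨F, hF, hFmem⟩ := exists_finite_scaled_mean hL hθ hXθ.nonempty (K + 1)
  -- The bound comes from `K * M ^ j / L ^ k + 1`, with `M ^ j ≤ M * (L ^ k + r)`.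
  obtain ⟨F', hF', hFmem'⟩ := exists_finite_scaled_mean hM hζ hXζ.nonempty (K * (M * (1 + r)) + 1)
  refine exists_pow_eq_pow_of_finite hL hM (hF.image2 (fun a b => a / b) hF') fun k => ?_
  have hn : 1 ≤ L ^ k := Nat.one_le_pow _ _ (by omega)
  -- The summand `r` is the radius of the inverse block code: the window `M ^ j` must determine `L ^
  -- k` letters of the preimage.
  obtain ⟨j, hj, hj'⟩ := exists_pow_between hM (n := L ^ k + r) (by omega)
  obtain ⟨d, hd⟩ := exists_hasMean hL hθ (f := (prefixSet x₀ (L ^ k)).indicator 1) (r := L ^ k)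
    (C := 1) (fun x y hxy => by
      classical
      have : x ∈ prefixSet x₀ (L ^ k) ↔ y ∈ prefixSet x₀ (L ^ k) := by
        refine forall₂_congr fun t ht => ?_
        rw [hxy t (by rw [Nat.abs_cast]; exact_mod_cast ht.le)]
      simp only [Set.indicator_apply, this, Pi.one_apply])
    (fun x => by
      classical
      rw [Set.indicator_apply]
      split_ifs <;> simp)
  have hpos : 0 < d := hd.pos hL hθ (isOpen_prefixSet x₀ _) hx₀ fun _ _ => rfl
  refine ⟨j, Set.mem_image2.2 ⟨_, hFmem k _ d ?_ ?_ hd, _,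
    hFmem' j _ d ?_ ?_ (hd.transport hψ), ?_⟩⟩
  · intro x _ y _ hxy
    refine forall₂_congr fun t ht => ?_
    rw [hxy t (by rw [Nat.abs_cast]; exact_mod_cast ht.le)]
  · intro x hx
    refine (visits_prefixSet_le hn hK x₀ hx _).trans_eq ?_
    rw [Nat.mul_div_cancel _ hn]
  · intro y hy y' hy' hyy
    have h : ∀ t : ℕ, t < L ^ k →
        (φ.symm ⟨y, hy⟩ : ℤ → A) t = (φ.symm ⟨y', hy'⟩ : ℤ → A) t := by
      intro t ht
      have e₁ := congrFun (coe_map_shift hψ hy t) 0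
      have e₂ := congrFun (coe_map_shift hψ hy' t) 0
      rw [shift_apply, add_zero] at e₁ e₂
      rw [← e₁, ← e₂]
      refine hr _ _ fun i hi => ?_
      change y (t + i) = y' (t + i)
      refine hyy _ ?_
      zify at hj ht
      rw [abs_le] at hi ⊢
      constructor <;> linarith
    have h' : (φ.symm ⟨y, hy⟩ : ℤ → A) ∈ prefixSet x₀ (L ^ k) ↔
        (φ.symm ⟨y', hy'⟩ : ℤ → A) ∈ prefixSet x₀ (L ^ k) :=
      forall₂_congr fun t ht => by rw [h t ht]
    exact ⟨fun ⟨_, hm⟩ => ⟨hy', h'.1 hm⟩, fun ⟨_, hm⟩ => ⟨hy, h'.2 hm⟩⟩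
  · intro y hy
    rw [visits_transport hψ _ hy]
    refine (visits_prefixSet_le hn hK x₀ (φ.symm ⟨y, hy⟩).2 _).trans ?_
    gcongr
    refine Nat.div_le_of_le_mul ?_
    calc K * M ^ j ≤ K * (M * (L ^ k + r)) := by gcongr
      _ ≤ K * (M * (L ^ k + L ^ k * r)) := by
          gcongr
          exact Nat.le_mul_of_pos_left r hn
      _ = _ := by ring
  -- The same `d` occurs in both systems and, being nonzero, cancels.
  · rw [mul_div_mul_right _ _ hpos.ne']

end ConstantLengthSubstitution

theorem mainTheorem1
    {A : Type*} [Finite A] [TopologicalSpace A] [DiscreteTopology A]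
    {B : Type*} [Finite B] [TopologicalSpace B] [DiscreteTopology B]
    {L M : ℕ} (hL : 2 ≤ L) (hM : 2 ≤ M)
    (θ : A → Fin L → A) (ζ : B → Fin M → B)
    (hθ : ConstantLengthSubstitution.IsPrimitive θ)
    (hζ : ConstantLengthSubstitution.IsPrimitive ζ)
    (hXθ : (ConstantLengthSubstitution.generatedSubshift θ).carrier.Infinite)
    (hXζ : (ConstantLengthSubstitution.generatedSubshift ζ).carrier.Infinite)
    (hconj : ConstantLengthSubstitution.TopologicallyConjugate
      (ConstantLengthSubstitution.sigma (ConstantLengthSubstitution.generatedSubshift θ))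
      (ConstantLengthSubstitution.sigma (ConstantLengthSubstitution.generatedSubshift ζ))) :
    ∃ c m n : ℕ, 1 ≤ m ∧ 1 ≤ n ∧ L = c ^ m ∧ M = c ^ n := by
  obtain ⟨a, b, ha, hb, h⟩ := ConstantLengthSubstitution.exists_pow_eq_pow_of_conjugate
    hL hM hθ hζ hXθ hXζ hconj
  -- The exponents are `b` and `a` divided by their gcd; `c` is positive since `L ≥ 2`.
  obtain ⟨c, hLc, hMc⟩ := Nat.exists_eq_pow_of_pow_eq_pow (Or.inl (by omega)) h
  exact ⟨c, _, _, Nat.div_pos (Nat.gcd_le_right _ hb) (Nat.gcd_pos_of_pos_left _ ha),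
    Nat.div_pos (Nat.gcd_le_left _ ha) (Nat.gcd_pos_of_pos_left _ ha), hLc, hMc⟩
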